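/- **Theorem 1.** Let $\mathcal V\subseteq\mathbb R^d$ be Borel measurable, let $\mathcal X$ be a Borel subset of a complete separable metric space, and let $(F_v : v\in\mathcal V)$ be probability measures on $\mathcal X$. For $k\in\{1,2,\ldots\}$ let $\Delta_k=\{w\in\mathbb R^k : w_i>0 \text{ for all } i,\ \sum_{i=1}^k w_i=1\}$ and $\Theta_k=\Delta_k\times\mathcal V^k$, and let $\Theta$ be the disjoint union $\bigcup_{k\ge 1}\Theta_k$. For $\theta=(w,v)\in\Theta_k$ write $k(\theta)=k$ and $P_\theta=\sum_{i=1}^k w_iF_{v_i}$. Give $\Theta$ the metric $d_\Theta(\theta,\theta')=\min\{\|\theta-\theta'\|,1\}$ (Euclidean norm in $\mathbb R^{k+kd}$) if $k(\theta)=k(\theta')=k$ and $d_\Theta(\theta,\theta')=1$ otherwise, and the resulting Borel $\sigma$-algebra. For a permutation $\sigma$ of $\{1,\ldots,k\}$ and $\theta=(w,v)\in\Theta_k$ let $\theta[\sigma]=((w_{\sigma_i})_i,(v_{\sigma_i})_i)$, and for $\theta_0\in\Theta_k$ and $\varepsilon>0$ let $\tilde B(\theta_0,\varepsilon)=\bigcup_{\sigma\in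 S_k}\{\theta\in\Theta : d_\Theta(\theta,\theta_0[\sigma])<\varepsilon\}$. Let $\pi$, $D_k$, $G_k$ be probability measures on $\{1,2,\ldots\}$, $\Delta_k$, $\mathcal V^k$ and consider the model $K\sim\pi$; given $K=k$, $W\sim D_k$ and $V\sim G_k$ independently; given $\boldsymbol\theta:=(W,V)$, the observations $X_1,X_2,\ldots$ are i.i.d. from $P_{\boldsymbol\theta}$. Assume that 1. for every measurable $A\subseteq\mathcal X$, the function $v\mapsto F_v(A)$ is measurable on $\mathcal V$; 2. for all $k,k'\ge 1$, $(w,v)\in\Theta_k$ and $(w',v')\in\Theta_{k'}$: if $P_{(w,v)}=P_{(w',v')}$ then $\sum_{i=1}^k w_i\delta_{v_i}=\sum_{i=1}^{k'} w'_i\delta_{v'_i}$; 3. for all $k$ with $\pi(\{k\})>0$ and all $1\le i<j\le k$, $\Pr(V_i=V_j\mid K=k)=0$. For each $n$ fix any version of the posterior, that is, of the regular conditional distribution of $\boldsymbol\theta$ given $(X_1,\ldots,X_n)$ under the model. Then there is a measurable set $\Theta_*\subseteq\Theta$ with $\Pr(\boldsymbol\theta\in\Theta_*)=1$ such that for every $\theta_0\in\Theta_*$,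 if $X_1,X_2,\ldots$ are i.i.d. from $P_{\theta_0}$, then for all $\varepsilon>0$ $$\lim_{n\to\infty}\Pr(\boldsymbol\theta\in\tilde B(\theta_0,\varepsilon)\mid X_1,\ldots,X_n)=1\quad\text{almost surely}$$ and $$\lim_{n\to\infty}\Pr(K=k(\theta_0)\mid X_1,\ldots,X_n)=1\quad\text{almost surely.}$$ -/

import Mathlib

open Set MeasureTheory ProbabilityTheory Filter Topology

noncomputable section

namespace FiniteMixture

/-- The set `Δ_k` of vectors of `k` strictly positive weights that sum to one. -/
def Simplex (k : ℕ) : Set (EuclideanSpace ℝ (Fin k)) :=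
  {w | (∀ i, 0 < w i) ∧ ∑ i, w i = 1}

/-- The parameter space `Θ = ⋃ₖ Δ_k × V^k` (disjoint union over `k ≥ 1`) for component parameters
in `V ⊆ ℝ^d`. Its sigma-algebra is the one of a countable disjoint union: a set is measurable iff
its trace on every `Δ_k × V^k` is Borel. See `generateFrom_isOpenParam`: this is the Borel
sigma-algebra of the metric `paramDist`. -/
abbrev Param {d : ℕ} (V : Set (EuclideanSpace ℝ (Fin d))) : Type :=
  Σ k : ℕ+, Simplex k × (Fin k → V)

variable {d : ℕ} {V : Set (EuclideanSpace ℝ (Fin d))}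

/-- The number of components `k(θ)`. -/
def Param.k (θ : Param V) : ℕ+ := θ.1

/-- The weights `w_1, …, w_k` of `θ = (w, v)`. -/
def Param.w (θ : Param V) (i : Fin θ.k) : ℝ := (θ.2.1 : EuclideanSpace ℝ (Fin θ.1)) i

/-- The component parameters `v_1, …, v_k` of `θ = (w, v)`. -/
def Param.v (θ : Param V) (i : Fin θ.k) : V := θ.2.2 i

/-- The metric on `Θ`: the Euclidean distance in `ℝ^(k + k d)` truncated at `1` if both parameters
have the same number `k` of components, and `1` otherwise. -/
def paramDist (θ θ' : Param V) : ℝ :=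
  if h : θ.k = θ'.k then
    min (Real.sqrt (∑ i, (θ.w i - θ'.w (Fin.cast (congrArg PNat.val h) i)) ^ 2
      + ∑ i, ‖(θ.v i : EuclideanSpace ℝ (Fin d)) -
          θ'.v (Fin.cast (congrArg PNat.val h) i)‖ ^ 2)) 1
  else 1

lemma paramDist_mk (k : ℕ+) (a b : Simplex k × (Fin k → V)) :
    paramDist (⟨k, a⟩ : Param V) ⟨k, b⟩ =
      min (Real.sqrt (‖(a.1 : EuclideanSpace ℝ (Fin k)) - b.1‖ ^ 2
        + ∑ i, ‖(a.2 i : EuclideanSpace ℝ (Fin d)) - b.2 i‖ ^ 2)) 1 := by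
  rw [EuclideanSpace.norm_sq_eq]
  simp only [PiLp.sub_apply, Real.norm_eq_abs, sq_abs]
  exact (dif_pos rfl).trans rfl

lemma paramDist_of_ne {θ θ' : Param V} (h : θ.1 ≠ θ'.1) : paramDist θ θ' = 1 := dif_neg h

lemma dist_le_paramDist (k : ℕ+) (a b : Simplex k × (Fin k → V)) :
    min (dist a b) 1 ≤ paramDist (⟨k, a⟩ : Param V) ⟨k, b⟩ := by
  rw [paramDist_mk]
  refine min_le_min_right _ ?_
  have h0 : 0 ≤ ∑ i, ‖(a.2 i : EuclideanSpace ℝ (Fin d)) - b.2 i‖ ^ 2 :=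
    Finset.sum_nonneg fun i _ => by positivity
  refine max_le ?_ ((dist_pi_le_iff (Real.sqrt_nonneg _)).2 fun i => ?_)
  · rw [Subtype.dist_eq, dist_eq_norm]
    exact Real.le_sqrt_of_sq_le (by linarith)
  · rw [Subtype.dist_eq, dist_eq_norm]
    refine Real.le_sqrt_of_sq_le ?_
    have := Finset.single_le_sum (f := fun i => ‖(a.2 i : EuclideanSpace ℝ (Fin d)) - b.2 i‖ ^ 2)
      (fun i _ => by positivity) (Finset.mem_univ i)
    have := sq_nonneg ‖(a.1 : EuclideanSpace ℝ (Fin k)) - b.1‖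
    linarith

/-- The Borel sigma-algebra of the metric `paramDist` on `Θ` is the sigma-algebra of the disjoint
union. -/
lemma generateFrom_isOpenParam :
    MeasurableSpace.generateFrom {U : Set (Param V) | ∀ θ ∈ U, ∃ ε : ℝ, 0 < ε ∧
      ∀ θ', paramDist θ θ' < ε → θ' ∈ U} = Sigma.instMeasurableSpace := by
  apply le_antisymm
  · refine MeasurableSpace.generateFrom_le fun U hU => ?_
    refine MeasurableSpace.measurableSet_iInf.2 fun k => ?_
    refine IsOpen.measurableSet (s := Sigma.mk k ⁻¹' U) ?_
    rw [isOpen_iff_mem_nhds]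
    intro a ha
    obtain ⟨ε, hε, h⟩ := hU _ ha
    have hc : Continuous fun b : Simplex k × (Fin k → V) =>
        paramDist (⟨k, a⟩ : Param V) ⟨k, b⟩ := by
      simp only [paramDist_mk]; fun_prop
    have h0 : paramDist (⟨k, a⟩ : Param V) ⟨k, a⟩ < ε := by simpa [paramDist_mk] using hε
    filter_upwards [hc.continuousAt.eventually_lt_const h0] with b hb using h _ hb
  · set m := MeasurableSpace.generateFrom {U : Set (Param V) | ∀ θ ∈ U, ∃ ε : ℝ, 0 < ε ∧
      ∀ θ', paramDist θ θ' < ε → θ' ∈ U} with hm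
    have hopen : ∀ k (t : Set (Simplex (k : ℕ+) × (Fin k → V))), IsOpen t →
        MeasurableSet[m] (Sigma.mk k '' t : Set (Param V)) := by
      intro k t ht
      refine MeasurableSpace.measurableSet_generateFrom ?_
      rintro _ ⟨a, ha, rfl⟩
      obtain ⟨δ, hδ, hb⟩ := Metric.isOpen_iff.1 ht a ha
      refine ⟨min δ 1, by positivity, ?_⟩
      rintro ⟨k', b⟩ hlt
      by_cases h : k = k'
      · subst h
        refine ⟨b, hb ?_, rfl⟩
        have h1 := (dist_le_paramDist k a b).trans_lt hlt
        rw [Metric.mem_ball, dist_comm]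
        by_contra h2
        exact absurd h1 (not_lt.2 (min_le_min_right _ (not_lt.1 h2)))
      · rw [paramDist_of_ne h] at hlt
        exact absurd hlt (not_lt.2 (min_le_right _ _))
    have hmeas : ∀ k (t : Set (Simplex (k : ℕ+) × (Fin k → V))), MeasurableSet t →
        MeasurableSet[m] (Sigma.mk k '' t : Set (Param V)) := by
      intro k t ht
      induction t, ht using MeasurableSet.induction_on_open with
      | isOpen U hU => exact hopen k U hU
      | compl t _ ih =>
        rw [compl_eq_univ_sdiff, image_sdiff sigma_mk_injective]
        exact (hopen k _ isOpen_univ).diff ih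
      | iUnion f _ _ ih =>
        rw [image_iUnion]
        exact MeasurableSet.iUnion ih
    intro s hs
    have hs' := MeasurableSpace.measurableSet_iInf.1 hs
    have : s = ⋃ k : ℕ+, Sigma.mk k '' (Sigma.mk k ⁻¹' s) := by
      ext ⟨k, a⟩
      constructor
      · intro h; exact mem_iUnion.2 ⟨k, a, h, rfl⟩
      · intro h
        obtain ⟨k', b, hb, he⟩ := mem_iUnion.1 h
        rwa [← he]
    rw [this]
    exact MeasurableSet.iUnion fun k => hmeas k _ (hs' k)

/-- Permuting coordinates stays in the simplex. -/
lemma permute_mem_simplex {k : ℕ} {w : EuclideanSpace ℝ (Fin k)} (hw : w ∈ Simplex k)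
    (σ : Equiv.Perm (Fin k)) : WithLp.toLp 2 (fun i => w (σ i)) ∈ Simplex k :=
  ⟨fun i => hw.1 (σ i), (Equiv.sum_comp σ (fun i => w i)).trans hw.2⟩

/-- The relabelled parameter `θ[σ] = (w_σ, v_σ)`. -/
def Param.permute (θ : Param V) (σ : Equiv.Perm (Fin θ.k)) : Param V :=
  ⟨θ.k, ⟨WithLp.toLp 2 (fun i => θ.w (σ i)), permute_mem_simplex θ.2.1.2 σ⟩, fun i => θ.v (σ i)⟩

/-- The `ε`-neighbourhood of `θ₀` up to a permutation of the component labels. -/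
def permBall (θ₀ : Param V) (ε : ℝ) : Set (Param V) :=
  ⋃ σ : Equiv.Perm (Fin θ₀.k), {θ | paramDist θ (θ₀.permute σ) < ε}

variable {X : Type*} [MeasurableSpace X]

/-- The mixture distribution `P_θ = ∑ i, w_i F_{v_i}`. -/
def mixture (F : V → Measure X) (θ : Param V) : Measure X :=
  ∑ i, ENNReal.ofReal (θ.w i) • F (θ.v i)

/-- The discrete mixing distribution `∑ i, w_i δ_{v_i}`. -/
def mixing (θ : Param V) : Measure V :=
  ∑ i, ENNReal.ofReal (θ.w i) • Measure.dirac (θ.v i)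

/-- Finite mixture identifiability. -/
def Identifiable (F : V → Measure X) : Prop :=
  ∀ θ θ' : Param V, mixture F θ = mixture F θ' → mixing θ = mixing θ'

/-- The prior distribution of `(W, V)` under the model `K ∼ π`, `W | K = k ∼ D_k`,
`V | K = k ∼ G_k` (with `W` and `V` independent given `K`). -/
def prior (π : PMF ℕ+) (D : ∀ k : ℕ+, Measure (Simplex k)) (G : ∀ k : ℕ+, Measure (Fin k → V)) :
    Measure (Param V) :=
  Measure.sum fun k => π k • ((D k).prod (G k)).map (Sigma.mk k)

instance isProbabilityMeasure_mixture (F : V → Measure X) [∀ v, IsProbabilityMeasure (F v)]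
    (θ : Param V) : IsProbabilityMeasure (mixture F θ) := by
  refine ⟨?_⟩
  have h : ∑ i, θ.w i = 1 := θ.2.1.2.2
  have h0 : ∀ i, 0 < θ.w i := θ.2.1.2.1
  simp [mixture, ← ENNReal.ofReal_sum_of_nonneg fun i _ => (h0 i).le, h]

lemma measurable_param {β : Type*} [MeasurableSpace β] {f : Param V → β}
    (hf : ∀ k, Measurable fun x => f ⟨k, x⟩) : Measurable f := by
  intro s hs
  exact MeasurableSpace.measurableSet_iInf.2 fun k => hf k hs

lemma measurable_mixture {F : V → Measure X}
    (hF : ∀ A : Set X, MeasurableSet A → Measurable fun v => F v A) {A : Set X}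
    (hA : MeasurableSet A) : Measurable fun θ : Param V => mixture F θ A := by
  refine measurable_param fun k => ?_
  simp only [mixture, Measure.coe_finsetSum, Finset.sum_apply, Measure.smul_apply, smul_eq_mul]
  have h : ∀ i : Fin k, Measurable fun x : Simplex k × (Fin k → V) =>
      ENNReal.ofReal ((x.1 : EuclideanSpace ℝ (Fin k)) i) * F (x.2 i) A := fun i =>
    (ENNReal.measurable_ofReal.comp (by fun_prop)).mul
      ((hF A hA).comp ((measurable_pi_apply i).comp measurable_snd))
  have hs := Finset.measurable_fun_sum (Finset.univ : Finset (Fin k)) fun i _ => h i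
  exact hs

/-- The law of `n` observations given the parameter: `θ ↦ P_θ^n`. -/
def sampling (F : V → Measure X) [∀ v, IsProbabilityMeasure (F v)]
    (hF : ∀ A : Set X, MeasurableSet A → Measurable fun v => F v A) (n : ℕ) :
    Kernel (Param V) (Fin n → X) where
  toFun θ := Measure.pi fun _ => mixture F θ
  measurable' := by
    refine Measurable.measure_of_isPiSystem_of_isProbabilityMeasure generateFrom_pi.symm
      isPiSystem_pi ?_
    rintro _ ⟨s, hs, rfl⟩
    simp only [Measure.pi_pi]
    exact Finset.measurable_fun_prod _ fun i _ => measurable_mixture hF (hs i (Set.mem_univ i))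

/-- `post` is a version of the posterior, that is, a regular conditional distribution of the
parameter given `(X_1, …, X_n)` under the joint law of `(X_1, …, X_n)` and the parameter, where
the parameter has law `Q` and `X_1, …, X_n` are i.i.d. from `P_θ` given the parameter `θ`. -/
def IsPosterior (F : V → Measure X) [∀ v, IsProbabilityMeasure (F v)]
    (hF : ∀ A : Set X, MeasurableSet A → Measurable fun v => F v A) (Q : Measure (Param V))
    (n : ℕ) (post : Kernel (Fin n → X) (Param V)) : Prop :=
  IsMarkovKernel post ∧ ((Q ⊗ₘ sampling F hF n).map Prod.swap).IsCondKernel post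

lemma measurableSet_simplex (k : ℕ) : MeasurableSet (Simplex k) := by
  have : Simplex k = (⋂ i, {w : EuclideanSpace ℝ (Fin k) | 0 < w i}) ∩ {w | ∑ i, w i = 1} := by
    ext; simp [Simplex]
  rw [this]
  refine (MeasurableSet.iInter fun i => measurableSet_lt measurable_const (by fun_prop)).inter
    (measurableSet_eq_fun (by fun_prop) measurable_const)

lemma measurableSet_borel_image {α β : Type*} [TopologicalSpace α] [MeasurableSpace α] [BorelSpace α]
    [TopologicalSpace β] {f : α → β} (hf : Topology.IsOpenEmbedding f) {s : Set α}
    (hs : MeasurableSet s) : MeasurableSet[borel β] (f '' s) := by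
  borelize β
  exact hf.measurableEmbedding.measurableSet_image.2 hs

lemma standardBorel_sigma {ι : Type*} [Countable ι] {β : ι → Type*}
    [∀ i, MeasurableSpace (β i)] [∀ i, StandardBorelSpace (β i)] :
    StandardBorelSpace (Σ i, β i) := by
  have hp : ∀ i, ∃ _ : TopologicalSpace (β i), BorelSpace (β i) ∧ PolishSpace (β i) :=
    fun i => StandardBorelSpace.polish
  choose τ hB hP using hp
  refine ⟨inferInstance, ⟨le_antisymm ?_ ?_⟩, inferInstance⟩
  · intro s hs
    have hs' := MeasurableSpace.measurableSet_iInf.1 hs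
    have : s = ⋃ k : ι, Sigma.mk k '' (Sigma.mk k ⁻¹' s) := by
      ext ⟨k, a⟩
      constructor
      · intro h; exact mem_iUnion.2 ⟨k, a, h, rfl⟩
      · intro h
        obtain ⟨k', b, hb, he⟩ := mem_iUnion.1 h
        rwa [← he]
    rw [this]
    refine MeasurableSet.iUnion fun k => ?_
    exact measurableSet_borel_image Topology.IsOpenEmbedding.sigmaMk (hs' k)
  · refine MeasurableSpace.generateFrom_le fun U hU => ?_
    refine MeasurableSpace.measurableSet_iInf.2 fun k => ?_
    exact (IsOpen.preimage continuous_sigmaMk hU).measurableSet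

lemma standardBorelSpace_param (hV : MeasurableSet V) : StandardBorelSpace (Param V) := by
  have := hV.standardBorel
  have := fun k => (measurableSet_simplex k).standardBorel
  exact standardBorel_sigma

instance isMarkovKernel_sampling (F : V → Measure X) [∀ v, IsProbabilityMeasure (F v)]
    (hF : ∀ A : Set X, MeasurableSet A → Measurable fun v => F v A) (n : ℕ) :
    IsMarkovKernel (sampling F hF n) :=
  ⟨fun θ => inferInstanceAs (IsProbabilityMeasure (Measure.pi fun _ : Fin n => mixture F θ))⟩

instance isProbabilityMeasure_prior (π : PMF ℕ+) (D : ∀ k : ℕ+, Measure (Simplex k))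
    [∀ k, IsProbabilityMeasure (D k)] (G : ∀ k : ℕ+, Measure (Fin k → V))
    [∀ k, IsProbabilityMeasure (G k)] : IsProbabilityMeasure (prior π D G) := by
  have hmk : ∀ k : ℕ+, Measurable (fun x : Simplex k × (Fin k → V) => (⟨k, x⟩ : Param V)) := by
    intro k s hs
    exact MeasurableSpace.measurableSet_iInf.1 hs k
  refine ⟨?_⟩
  simp [prior, Measure.sum_apply _ MeasurableSet.univ, Measure.map_apply (hmk _) MeasurableSet.univ,
    π.tsum_coe]

/-- Versions of the posterior exist. -/
lemma exists_isPosterior (hV : MeasurableSet V) (F : V → Measure X) [∀ v, IsProbabilityMeasure (F v)]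
    (hF : ∀ A : Set X, MeasurableSet A → Measurable fun v => F v A) (Q : Measure (Param V))
    [IsProbabilityMeasure Q] (n : ℕ) : ∃ post, IsPosterior F hF Q n post := by
  have := standardBorelSpace_param hV
  have : Nonempty (Param V) := Q.nonempty_of_neZero
  exact ⟨((Q ⊗ₘ sampling F hF n).map Prod.swap).condKernel, inferInstance, inferInstance⟩

end FiniteMixture

end

/-! This is Doob's argument. Under the joint law of the parameter and the whole sequence of
observations, the strong law of large numbers recovers the probabilities of a countable determining
family of events, hence `P_θ`. By identifiability, `P_θ` fixes the mixing distribution, whose atoms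
and masses give `θ` up to relabelling as long as the components are distinct, which holds almost
surely. So for a relabelling-invariant measurable `B`, the event `θ ∈ B` coincides almost surely
with an event of the observations. Lévy's upward theorem then makes the posterior probability of `B`
converge to the indicator of `B`, and Fubini turns this into a statement for almost every `θ`
(`ae_tendsto_posterior`).

The exceptional null set depends on `B`. It is enough to take for `B` the relabelling saturations of
a countable basis of open sets, since for each `θ₀` some of them contain `θ₀` and lie in `permBall
θ₀ ε`. -/

/-! ### Recovering a law from observed frequencies -/

/-- A countable family of events determines every probability measure on a countably generated
space. -/
lemma exists_seq_measurableSet_determining (X : Type*) [MeasurableSpace X]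
    [MeasurableSpace.CountablyGenerated X] :
    ∃ A : ℕ → Set X, (∀ j, MeasurableSet (A j)) ∧
      ∀ (μ ν : Measure X) [IsProbabilityMeasure μ] [IsProbabilityMeasure ν],
        (∀ j, μ (A j) = ν (A j)) → μ = ν := by
  -- The algebra generated by a countable family is still countable, and it is a π-system.
  set S := generateSetAlgebra (MeasurableSpace.countableGeneratingSet X) with hS
  have hgen : MeasurableSpace.generateFrom S = ‹MeasurableSpace X› := by
    rw [hS, generateFrom_generateSetAlgebra_eq,
      MeasurableSpace.generateFrom_countableGeneratingSet]
  have halg : IsSetAlgebra S := isSetAlgebra_generateSetAlgebra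
  obtain ⟨A, hA⟩ := (countable_generateSetAlgebra
    (MeasurableSpace.countable_countableGeneratingSet (α := X))).exists_eq_range
    ⟨∅, halg.empty_mem⟩
  refine ⟨A, fun j => ?_, fun μ ν _ _ h => ?_⟩
  · rw [← hgen]
    exact MeasurableSpace.measurableSet_generateFrom (by rw [hS, hA]; exact mem_range_self j)
  · refine ext_of_generate_finite S hgen.symm
      (fun s hs t ht _ => halg.inter_mem hs ht) (fun s hs => ?_) (by simp)
    rw [hS, hA] at hs
    obtain ⟨j, rfl⟩ := hs
    exact h j

/-- The asymptotic upper frequency of visits of a sequence to a set. -/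
noncomputable def limsupFreq {X : Type*} (A : Set X) (x : ℕ → X) : ℝ :=
  -- The limsup is measurable and defined for every sequence, even where the frequencies diverge;
  -- they lie in `[0, 1]`, so it is never a default value.
  limsup (fun n : ℕ => (∑ i ∈ Finset.range n, A.indicator (fun _ => (1 : ℝ)) (x i)) / n) atTop

lemma measurable_limsupFreq {X : Type*} [MeasurableSpace X] {A : Set X} (hA : MeasurableSet A) :
    Measurable (limsupFreq A) := by
  have hm : Measurable (A.indicator fun _ => (1 : ℝ)) := measurable_const.indicator hA
  exact Measurable.limsup fun n => (Finset.measurable_sum _ fun i _ =>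
    hm.comp (measurable_pi_apply i)).div_const _

/-- Under i.i.d. sampling the frequency of an event converges to its probability. -/
lemma ae_limsupFreq_eq {X : Type*} [MeasurableSpace X] (P : Measure X) [IsProbabilityMeasure P]
    {A : Set X} (hA : MeasurableSet A) :
    ∀ᵐ x ∂Measure.infinitePi (fun _ : ℕ => P), limsupFreq A x = P.real A := by
  have hm : Measurable (A.indicator fun _ => (1 : ℝ)) := measurable_const.indicator hA
  have hlaw : ∀ i, (Measure.infinitePi fun _ : ℕ => P).map (fun x => x i) = P :=
    Measure.infinitePi_map_eval _
  have hind := iIndepFun_infinitePi (P := fun _ : ℕ => P)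
    (X := fun _ => A.indicator fun _ => (1 : ℝ)) fun _ => hm
  have hid : ∀ i, IdentDistrib (fun x : ℕ → X => A.indicator (fun _ => (1 : ℝ)) (x i))
      (fun x : ℕ → X => A.indicator (fun _ => (1 : ℝ)) (x 0))
      (Measure.infinitePi fun _ : ℕ => P) (Measure.infinitePi fun _ : ℕ => P) := fun i =>
    IdentDistrib.comp (u := A.indicator fun _ => (1 : ℝ))
      ⟨(measurable_pi_apply i).aemeasurable, (measurable_pi_apply 0).aemeasurable,
        by rw [hlaw, hlaw]⟩ hm
  have hint : Integrable (fun x : ℕ → X => A.indicator (fun _ => (1 : ℝ)) (x 0))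
      (Measure.infinitePi fun _ : ℕ => P) := by
    have : Integrable ((fun x : ℕ → X => x 0) ⁻¹' A |>.indicator fun _ => (1 : ℝ))
        (Measure.infinitePi fun _ : ℕ => P) :=
      (integrable_const _).indicator (measurable_pi_apply 0 hA)
    exact this
  have hmean : ∫ x, A.indicator (fun _ => (1 : ℝ)) (x 0) ∂(Measure.infinitePi fun _ : ℕ => P)
      = P.real A := by
    rw [← integral_map (φ := fun x : ℕ → X => x 0)
      (measurable_pi_apply 0).aemeasurable hm.aestronglyMeasurable, hlaw,
      integral_indicator_const _ hA, smul_eq_mul, mul_one]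
  filter_upwards [strong_law_ae_real _ hint (fun i j hij => hind.indepFun hij) hid] with x hx
  rw [hmean] at hx
  exact hx.limsup_eq

/-! ### Infinite samples and the filtration of the observations -/

/-- The law of an i.i.d. sequence as a kernel in the law of one observation. -/
noncomputable def iidKernel {T X : Type*} [MeasurableSpace T] [MeasurableSpace X]
    (κ : Kernel T X) [IsMarkovKernel κ] : Kernel T (ℕ → X) where
  toFun θ := Measure.infinitePi fun _ => κ θ
  measurable' := by
    refine Measurable.measure_of_isPiSystem_of_isProbabilityMeasure
      (generateFrom_squareCylinders (α := fun _ : ℕ => X)).symm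
      (isPiSystem_squareCylinders (fun _ => MeasurableSpace.isPiSystem_measurableSet)
        fun _ => MeasurableSet.univ) ?_
    rintro _ ⟨s, t, ht, rfl⟩
    have ht' : ∀ i, MeasurableSet (t i) := fun i => ht i (mem_univ i)
    simp only [Measure.infinitePi_pi _ fun i _ => ht' i]
    exact Finset.measurable_fun_prod _ fun i _ => κ.measurable_coe (ht' i)

lemma iidKernel_apply {T X : Type*} [MeasurableSpace T] [MeasurableSpace X]
    (κ : Kernel T X) [IsMarkovKernel κ] (θ : T) :
    iidKernel κ θ = Measure.infinitePi fun _ => κ θ := rfl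

instance isMarkovKernel_iidKernel {T X : Type*} [MeasurableSpace T] [MeasurableSpace X]
    (κ : Kernel T X) [IsMarkovKernel κ] : IsMarkovKernel (iidKernel κ) :=
  ⟨fun θ => inferInstanceAs (IsProbabilityMeasure (Measure.infinitePi fun _ => κ θ))⟩

/-- The first `n` terms of an i.i.d. sequence are an i.i.d. sample of size `n`. -/
lemma map_fin_infinitePi {X : Type*} [MeasurableSpace X] (P : Measure X) [IsProbabilityMeasure P]
    (n : ℕ) : (Measure.infinitePi fun _ : ℕ => P).map (fun x (i : Fin n) => x i)
      = Measure.pi fun _ => P := by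
  rw [← Measure.infinitePi_eq_pi]
  exact Measure.map_infinitePi_infinitePi_of_inj (P := fun _ : ℕ => P) Fin.val_injective

/-- The filtration on parameters and observations generated by the observations. -/
def obsFiltration (T X : Type*) [MeasurableSpace T] [MeasurableSpace X] :
    Filtration ℕ (inferInstance : MeasurableSpace (T × (ℕ → X))) where
  seq n := MeasurableSpace.comap (fun p (i : Fin n) => p.2 i) inferInstance
  mono' := by
    intro m n hmn
    have h : Measurable fun (y : Fin n → X) (i : Fin m) => y (Fin.castLE hmn i) := by fun_prop
    rintro _ ⟨s, hs, rfl⟩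
    exact ⟨_, h hs, rfl⟩
  le' n := Measurable.comap_le (by fun_prop)

/-- Coordinate `i` is already known at time `i + 1`. Hence Lévy's theorem has the indicator itself
as limit for every event of the observations. -/
lemma measurable_snd_iSup_obsFiltration (T X : Type*) [MeasurableSpace T] [MeasurableSpace X] :
    Measurable[⨆ n, obsFiltration T X n] (Prod.snd : T × (ℕ → X) → ℕ → X) := by
  refine @measurable_pi_lambda _ _ _ (⨆ n, obsFiltration T X n) _ _ fun i => ?_
  refine Measurable.mono (ma := obsFiltration T X (i + 1))
    ?_ (le_iSup (fun n => (obsFiltration T X n : MeasurableSpace _)) (i + 1)) le_rfl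
  exact (measurable_pi_apply (Fin.last i)).comp
    (comap_measurable fun (p : T × (ℕ → X)) (j : Fin (i + 1)) => p.2 j)

/-! ### Doob's theorem -/

/-- Two measurable sets whose images under a measurable map do not meet are separated by the
preimage of a measurable set. -/
lemma exists_measurableSet_separating {T Y : Type*} [MeasurableSpace T] [StandardBorelSpace T]
    [MeasurableSpace Y] [StandardBorelSpace Y] {Φ : T → Y}
    (hΦ : Measurable Φ) {S S' : Set T} (hS : MeasurableSet S) (hS' : MeasurableSet S')
    (h : ∀ θ ∈ S, ∀ θ' ∈ S', Φ θ ≠ Φ θ') :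
    ∃ C, MeasurableSet C ∧ (∀ θ ∈ S, Φ θ ∈ C) ∧ ∀ θ ∈ S', Φ θ ∉ C := by
  let := upgradeStandardBorel Y
  have hd : Disjoint (Φ '' S) (Φ '' S') := by
    rw [Set.disjoint_left]
    rintro _ ⟨θ, hθ, rfl⟩ ⟨θ', hθ', he⟩
    exact h θ hθ θ' hθ' he.symm
  -- The images are analytic but need not be Borel; Lusin's theorem separates disjoint analytic sets
  -- by a Borel set.
  obtain ⟨C, h1, h2, hC⟩ :=
    (hS.analyticSet_image hΦ).measurablySeparable (hS'.analyticSet_image hΦ) hd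
  exact ⟨C, hC, fun θ hθ => h1 (mem_image_of_mem _ hθ),
    fun θ hθ => Set.disjoint_left.1 h2 (mem_image_of_mem _ hθ)⟩

/-- **Doob's theorem**: if almost surely the law of an observation tells whether the parameter lies
in `B`, then the posterior probability of `B` converges to the indicator of `B`. -/
theorem ae_tendsto_posterior {T X : Type*} [MeasurableSpace T] [StandardBorelSpace T]
    [MeasurableSpace X] [MeasurableSpace.CountablyGenerated X]
    (κ : Kernel T X) [IsMarkovKernel κ] (Q : Measure T) [IsProbabilityMeasure Q]
    (post : ∀ n : ℕ, Kernel (Fin n → X) T) [∀ n, IsMarkovKernel (post n)]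
    (hpost : ∀ n, (Q ⊗ₘ iidKernel κ).map (fun p => ((fun i : Fin n => p.2 i), p.1))
      = (Q ⊗ₘ iidKernel κ).map (fun p (i : Fin n) => p.2 i) ⊗ₘ post n)
    {R B : Set T} (hR : MeasurableSet R) (hRQ : ∀ᵐ θ ∂Q, θ ∈ R) (hB : MeasurableSet B)
    (hRB : ∀ θ ∈ R, ∀ θ' ∈ R, κ θ = κ θ' → θ ∈ B → θ' ∈ B) :
    ∀ᵐ θ ∂Q, θ ∈ B → ∀ᵐ x ∂Measure.infinitePi (fun _ : ℕ => κ θ),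
      Tendsto (fun n => post n (fun i => x i) B) atTop (𝓝 1) := by
  have : Nonempty T := Q.nonempty_of_neZero
  set M := Q ⊗ₘ iidKernel κ with hM
  obtain ⟨A, hA, hdet⟩ := exists_seq_measurableSet_determining X
  -- The law of one observation is encoded by its values on the `A j`. On `R` this code decides
  -- membership in `B`, so the codes of `R ∩ B` and `R \ B` are disjoint; separating them avoids any
  -- measurable inverse of `Φ`.
  obtain ⟨C, hC, hBC, hBC'⟩ := exists_measurableSet_separating
    (Φ := fun θ j => (κ θ).real (A j))
    (measurable_pi_lambda _ fun j => (κ.measurable_coe (hA j)).ennreal_toReal)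
    (hR.inter hB) (hR.diff hB) (by
      rintro θ ⟨h1, h2⟩ θ' ⟨h3, h4⟩ he
      refine h4 (hRB θ h1 θ' h3 (hdet _ _ fun j => ?_) h2)
      rw [← ofReal_measureReal, ← ofReal_measureReal]
      exact congrArg _ (congrFun he j))
  have hL : Measurable fun (x : ℕ → X) j => limsupFreq (A j) x :=
    measurable_pi_lambda _ fun j => measurable_limsupFreq (hA j)
  set E : Set (ℕ → X) := (fun x j => limsupFreq (A j) x) ⁻¹' C with hE
  have hEm : MeasurableSet E := hL hC
  have hfreq : ∀ᵐ p ∂M, (fun j => limsupFreq (A j) p.2) = fun j => (κ p.1).real (A j) := by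
    refine (Measure.ae_compProd_iff ?_).2 (Eventually.of_forall fun θ => ?_)
    · exact measurableSet_eq_fun (hL.comp measurable_snd)
        (measurable_pi_lambda _ fun j =>
          ((κ.measurable_coe (hA j)).comp measurable_fst).ennreal_toReal)
    · filter_upwards [ae_all_iff.2 fun j => ae_limsupFreq_eq (κ θ) (hA j)] with x hx
      exact funext hx
  have hRM : ∀ᵐ p ∂M, p.1 ∈ R := by
    refine (Measure.ae_compProd_iff (measurable_fst hR)).2 ?_
    filter_upwards [hRQ] with θ hθ using Eventually.of_forall fun _ => hθ
  -- Frequencies equal the code of the parameter almost surely, so `E` is an event of the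
  -- observations that almost surely agrees with `B`.
  have hBE : (Prod.fst ⁻¹' B : Set (T × (ℕ → X))) =ᵐ[M] (Prod.snd ⁻¹' E : Set (T × (ℕ → X))) := by
    filter_upwards [hfreq, hRM] with p hp hpR
    have : p.1 ∈ B ↔ p.2 ∈ E := by
      rw [hE, mem_preimage, hp]
      exact ⟨fun h => hBC _ ⟨hpR, h⟩, fun h => by_contra fun h' => hBC' _ ⟨hpR, h'⟩ h⟩
    exact propext this
  have hlevy : ∀ᵐ p ∂M, Tendsto (fun n => (M[(Prod.snd ⁻¹' E : Set (T × (ℕ → X))).indicator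
      (fun _ => (1 : ℝ)) | obsFiltration T X n]) p) atTop
      (𝓝 ((Prod.snd ⁻¹' E : Set (T × (ℕ → X))).indicator (fun _ => (1 : ℝ)) p)) := by
    refine Integrable.tendsto_ae_condExp
      ((integrable_const _).indicator (measurable_snd hEm)) ?_
    exact StronglyMeasurable.indicator stronglyMeasurable_const
      (measurable_snd_iSup_obsFiltration T X hEm)
  have hcond : ∀ n, ∀ᵐ p ∂M, (post n (fun i => p.2 i)).real B =
      (M[(Prod.snd ⁻¹' E : Set (T × (ℕ → X))).indicator
        (fun _ => (1 : ℝ)) | obsFiltration T X n]) p := by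
    intro n
    have hm : Measurable fun (p : T × (ℕ → X)) (i : Fin n) => p.2 i := by fun_prop
    -- By uniqueness of conditional distributions, any version of the posterior gives the
    -- conditional expectation of the indicator of `B`, which `hBE` replaces by that of `E`.
    have h1 := condDistrib_ae_eq_of_measure_eq_compProd (μ := M) (Y := Prod.fst)
      (fun (p : T × (ℕ → X)) (i : Fin n) => p.2 i) measurable_fst.aemeasurable (hpost n)
    have h2 := condDistrib_ae_eq_condExp (μ := M) hm measurable_fst hB
    have h3 : M[(Prod.fst ⁻¹' B : Set (T × (ℕ → X))).indicator (fun _ => (1 : ℝ)) |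
        obsFiltration T X n] =ᵐ[M] M[(Prod.snd ⁻¹' E : Set (T × (ℕ → X))).indicator
        (fun _ => (1 : ℝ)) | obsFiltration T X n] :=
      condExp_congr_ae (indicator_ae_eq_of_ae_eq_set hBE)
    filter_upwards [ae_of_ae_map hm.aemeasurable h1, h2, h3] with p h1 h2 h3
    rw [← h3, ← h1]
    exact h2
  have hjoint : ∀ᵐ p ∂M, p.1 ∈ B →
      Tendsto (fun n => post n (fun i => p.2 i) B) atTop (𝓝 1) := by
    filter_upwards [hlevy, ae_all_iff.2 hcond, hBE] with p h1 h2 h3 hp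
    have hpE : p ∈ (Prod.snd ⁻¹' E : Set (T × (ℕ → X))) := h3.mp hp
    rw [indicator_of_mem hpE] at h1
    simp only [← h2] at h1
    simpa using (ENNReal.tendsto_ofReal h1)
  filter_upwards [Measure.ae_ae_of_ae_compProd hjoint] with θ hθ hθB
  filter_upwards [hθ] with x hx using hx hθB

/-! ### Relabelling and identifiability of the parameter -/

namespace FiniteMixture

variable {d : ℕ} {V : Set (EuclideanSpace ℝ (Fin d))}

lemma Param.permute_permute (θ : Param V) (σ τ : Equiv.Perm (Fin θ.k)) :
    (θ.permute σ).permute τ = θ.permute (σ * τ) := rfl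

/-- The parameters with a relabelling in `U`. -/
def relabelSat (U : Set (Param V)) : Set (Param V) := {θ | ∃ σ, θ.permute σ ∈ U}

lemma permute_mem_relabelSat {U : Set (Param V)} {θ : Param V} (h : θ ∈ relabelSat U)
    (σ : Equiv.Perm (Fin θ.k)) : θ.permute σ ∈ relabelSat U := by
  obtain ⟨τ, hτ⟩ := h
  refine ⟨σ⁻¹ * τ, ?_⟩
  rw [Param.permute_permute]
  rwa [mul_inv_cancel_left]

lemma subset_relabelSat (U : Set (Param V)) : U ⊆ relabelSat U := fun _ h => ⟨1, h⟩

lemma measurable_sigmaMk_param (k : ℕ+) :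
    Measurable fun x : Simplex k × (Fin k → V) => (⟨k, x⟩ : Param V) :=
  fun _ hs => MeasurableSpace.measurableSet_iInf.1 hs k

lemma measurableSet_relabelSat {U : Set (Param V)} (hU : MeasurableSet U) :
    MeasurableSet (relabelSat U) := by
  refine MeasurableSpace.measurableSet_iInf.2 fun k => ?_
  have hp : ∀ σ : Equiv.Perm (Fin k), Measurable fun x : Simplex k × (Fin k → V) =>
      Param.permute (⟨k, x⟩ : Param V) σ := by
    intro σ
    refine (measurable_sigmaMk_param k).comp (Measurable.prodMk ?_ ?_)
    · refine Measurable.subtype_mk ?_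
      have h : Measurable fun x : Simplex k × (Fin k → V) =>
          (fun i => (x.1 : EuclideanSpace ℝ (Fin k)) (σ i)) := by fun_prop
      exact (WithLp.measurable_toLp 2 (Fin k → ℝ)).comp h
    · exact measurable_pi_lambda _ fun i => (measurable_pi_apply (σ i)).comp measurable_snd
  have : Sigma.mk k ⁻¹' relabelSat U = ⋃ σ : Equiv.Perm (Fin k),
      (fun x : Simplex k × (Fin k → V) => Param.permute (⟨k, x⟩ : Param V) σ) ⁻¹' U := by
    ext x; simp only [mem_iUnion]; rfl
  change MeasurableSet (Sigma.mk k ⁻¹' relabelSat U)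
  rw [this]
  exact MeasurableSet.iUnion fun σ => hp σ hU

/-- The parameters with pairwise distinct components. -/
def distinctParams (V : Set (EuclideanSpace ℝ (Fin d))) : Set (Param V) :=
  {θ | ∀ i j, i < j → θ.v i ≠ θ.v j}

lemma injective_of_mem_distinctParams {θ : Param V} (h : θ ∈ distinctParams V) :
    Function.Injective θ.v := by
  intro i j hij
  rcases lt_trichotomy i j with hlt | heq | hgt
  · exact absurd hij (h i j hlt)
  · exact heq
  · exact absurd hij.symm (h j i hgt)

lemma sigmaMk_preimage_distinctParams (k : ℕ+) :
    Sigma.mk k ⁻¹' distinctParams V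
      = {x : Simplex k × (Fin k → V) | ∀ i j, i < j → x.2 i ≠ x.2 j} := rfl

lemma measurableSet_distinctParams : MeasurableSet (distinctParams V) := by
  refine MeasurableSpace.measurableSet_iInf.2 fun k => ?_
  change MeasurableSet (Sigma.mk k ⁻¹' distinctParams V)
  rw [sigmaMk_preimage_distinctParams]
  simp only [ofPred_forall]
  refine MeasurableSet.iInter fun i => MeasurableSet.iInter fun j => MeasurableSet.iInter fun _ =>
    (measurableSet_eq_fun ?_ ?_).compl
  · exact (measurable_pi_apply i).comp measurable_snd
  · exact (measurable_pi_apply j).comp measurable_snd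

lemma ae_mem_distinctParams {π : PMF ℕ+}
    {D : ∀ k : ℕ+, Measure (Simplex k)} [∀ k, IsProbabilityMeasure (D k)]
    {G : ∀ k : ℕ+, Measure (Fin k → V)} [∀ k, IsProbabilityMeasure (G k)]
    (hdistinct : ∀ k : ℕ+, π k ≠ 0 → ∀ i j : Fin k, i < j → G k {v | v i = v j} = 0) :
    ∀ᵐ θ ∂prior π D G, θ ∈ distinctParams V := by
  rw [prior, Measure.ae_sum_iff]
  intro k
  by_cases hk : π k = 0
  · simp [hk]
  refine Measure.ae_smul_measure ?_ _
  refine (ae_map_iff (measurable_sigmaMk_param k).aemeasurable measurableSet_distinctParams).2 ?_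
  have hG : ∀ᵐ v ∂G k, ∀ i j : Fin k, i < j → v i ≠ v j := by
    refine ae_all_iff.2 fun i => ae_all_iff.2 fun j => ?_
    by_cases hij : i < j
    · have : ∀ᵐ v ∂G k, ¬ v i = v j := by
        rw [ae_iff]; simpa using hdistinct k hk i j hij
      filter_upwards [this] with v hv _ using hv
    · exact Eventually.of_forall fun v h => absurd h hij
  exact Measure.quasiMeasurePreserving_snd.ae hG

/-- Distinct components do not merge into one atom, so each weight is the mass of its atom. -/
lemma mixing_singleton {θ : Param V} (h : Function.Injective θ.v) (i : Fin θ.k) :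
    mixing θ {θ.v i} = ENNReal.ofReal (θ.w i) := by
  simp only [mixing, Measure.coe_finsetSum, Finset.sum_apply, Measure.smul_apply, smul_eq_mul]
  rw [Finset.sum_eq_single i]
  · simp
  · intro j _ hj
    rw [Measure.dirac_apply' _ (measurableSet_singleton _), indicator_of_notMem, mul_zero]
    exact fun hm => hj (h hm)
  · simp

/-- Every weight is strictly positive, so no component is invisible. -/
lemma mixing_singleton_ne_zero_iff (θ : Param V) (u : V) :
    mixing θ {u} ≠ 0 ↔ u ∈ range θ.v := by
  have hw : ∀ i, 0 < θ.w i := θ.2.1.2.1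
  simp only [mixing, Measure.coe_finsetSum, Finset.sum_apply, Measure.smul_apply, smul_eq_mul, ne_eq,
    Finset.sum_eq_zero_iff, Measure.dirac_apply' _ (measurableSet_singleton u)]
  simp [hw, mem_range, Pi.single_apply]

/-- The component set is the set of atoms; injectivity makes its cardinality the number of
components, and matching atoms defines the permutation. Comparing masses then matches the weights.
-/
lemma exists_permute_eq_of_mixing_eq {θ θ' : Param V} (hθ : Function.Injective θ.v)
    (hθ' : Function.Injective θ'.v) (h : mixing θ = mixing θ') : ∃ σ, θ' = θ.permute σ := by
  have hr : range θ'.v = range θ.v := by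
    ext u
    rw [← mixing_singleton_ne_zero_iff, ← mixing_singleton_ne_zero_iff, h]
  have hk : θ.k = θ'.k := by
    have e : Fin θ'.k ≃ Fin θ.k :=
      (Equiv.ofInjective _ hθ').trans ((Equiv.setCongr hr).trans (Equiv.ofInjective _ hθ).symm)
    have := Fintype.card_congr e
    simp only [Fintype.card_fin] at this
    exact (PNat.coe_injective this).symm
  obtain ⟨k, w, v⟩ := θ
  obtain ⟨k', w', v'⟩ := θ'
  obtain rfl : k = k' := hk
  let σ : Equiv.Perm (Fin k) :=
    (Equiv.ofInjective v' hθ').trans ((Equiv.setCongr hr).trans (Equiv.ofInjective v hθ).symm)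
  have hv : ∀ i, v' i = v (σ i) := by
    intro i
    exact (congrArg Subtype.val ((Equiv.ofInjective v hθ).apply_symm_apply
      (Equiv.setCongr hr (Equiv.ofInjective v' hθ' i)))).symm
  have hw : ∀ i, (w' : EuclideanSpace ℝ (Fin k)) i = (w : EuclideanSpace ℝ (Fin k)) (σ i) := by
    intro i
    have h1 := mixing_singleton hθ (σ i)
    have h2 := mixing_singleton hθ' i
    have h3 : Param.v (⟨k, w, v⟩ : Param V) (σ i) = Param.v (⟨k, w', v'⟩ : Param V) i := (hv i).symm
    rw [h3, h, h2] at h1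
    exact (ENNReal.ofReal_eq_ofReal_iff (w'.2.1 i).le (w.2.1 (σ i)).le).1 h1
  refine ⟨σ, ?_⟩
  have e1 : w' = ⟨WithLp.toLp 2 (fun i => (w : EuclideanSpace ℝ (Fin k)) (σ i)),
      permute_mem_simplex w.2 σ⟩ := Subtype.ext (by ext i; exact hw i)
  have e2 : v' = fun i => v (σ i) := funext hv
  rw [e1, e2]
  rfl

/-! ### Neighbourhoods up to relabelling -/

/-- Relabelling one argument of the metric amounts to relabelling the other one. -/
lemma exists_paramDist_permute_eq (θ θ₀ : Param V) (σ : Equiv.Perm (Fin θ.k)) :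
    ∃ τ, paramDist θ (θ₀.permute τ) = paramDist (θ.permute σ) θ₀ := by
  by_cases hk : θ.1 = θ₀.1
  · obtain ⟨k, w, v⟩ := θ
    obtain ⟨k', w₀, v₀⟩ := θ₀
    obtain rfl : k = k' := hk
    -- Reindexing both sums by `σ` moves the permutation to the other argument as its inverse.
    refine ⟨σ⁻¹, ?_⟩
    change Equiv.Perm (Fin k) at σ
    unfold Param.permute
    refine (paramDist_mk k _ _).trans (Eq.trans ?_ (paramDist_mk k _ _).symm)
    rw [EuclideanSpace.norm_sq_eq, EuclideanSpace.norm_sq_eq]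
    congr 3
    · refine (Equiv.sum_comp σ _).symm.trans (Finset.sum_congr rfl fun i _ => ?_)
      change ‖w.1 (σ i) - w₀.1 (σ⁻¹ (σ i))‖ ^ 2 = ‖w.1 (σ i) - w₀.1 i‖ ^ 2
      rw [σ.coe_inv, Equiv.symm_apply_apply]
    · refine (Equiv.sum_comp σ _).symm.trans (Finset.sum_congr rfl fun i _ => ?_)
      change ‖(v (σ i) : EuclideanSpace ℝ (Fin d)) - v₀ (σ⁻¹ (σ i))‖ ^ 2
        = ‖(v (σ i) : EuclideanSpace ℝ (Fin d)) - v₀ i‖ ^ 2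
      rw [σ.coe_inv, Equiv.symm_apply_apply]
  · exact ⟨1, (paramDist_of_ne (θ := θ) (θ' := θ₀.permute 1) hk).trans
      (paramDist_of_ne (θ := θ.permute σ) hk).symm⟩

lemma continuous_paramDist_left (θ₀ : Param V) : Continuous fun θ : Param V => paramDist θ θ₀ := by
  refine continuous_sigma fun k => ?_
  by_cases hk : k = θ₀.1
  · obtain ⟨k', b⟩ := θ₀
    obtain rfl : k = k' := hk
    simp only [paramDist_mk]
    fun_prop
  · have : (fun x : Simplex k × (Fin k → V) => paramDist (⟨k, x⟩ : Param V) θ₀) = fun _ => 1 :=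
      funext fun x => paramDist_of_ne hk
    rw [this]
    exact continuous_const

lemma paramDist_self (θ : Param V) : paramDist θ θ = 0 := by
  obtain ⟨k, a⟩ := θ
  simp [paramDist_mk]

lemma measurableSet_of_isOpen_param {U : Set (Param V)} (hU : IsOpen U) : MeasurableSet U :=
  MeasurableSpace.measurableSet_iInf.2 fun _ => (isOpen_sigma_iff.1 hU _).measurableSet

lemma relabelSat_subset_permBall {U : Set (Param V)} {θ₀ : Param V} {ε : ℝ}
    (hU : ∀ θ ∈ U, paramDist θ θ₀ < ε) : relabelSat U ⊆ permBall θ₀ ε := by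
  rintro θ ⟨σ, hσ⟩
  obtain ⟨τ, hτ⟩ := exists_paramDist_permute_eq θ θ₀ σ
  exact mem_iUnion.2 ⟨τ, (hτ.trans_lt (hU _ hσ) : paramDist θ (θ₀.permute τ) < ε)⟩

/-- Parameters with different numbers of components are at distance exactly `1`, and the inequality
in `permBall` is strict. -/
lemma permBall_one_subset (θ₀ : Param V) : permBall θ₀ 1 ⊆ {θ | θ.k = θ₀.k} := by
  intro θ hθ
  obtain ⟨σ, hσ⟩ := mem_iUnion.1 hθ
  by_contra h
  have hσ' : paramDist θ (θ₀.permute σ) < 1 := hσ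
  rw [paramDist_of_ne (θ := θ) (θ' := θ₀.permute σ) h] at hσ'
  exact lt_irrefl _ hσ'

/-! ### Posteriors and i.i.d. samples of the mixture model -/

variable {X : Type*} [MeasurableSpace X]

/-- The law of one observation as a kernel in the parameter. -/
noncomputable def mixtureKernel (F : V → Measure X)
    (hF : ∀ A : Set X, MeasurableSet A → Measurable fun v => F v A) : Kernel (Param V) X where
  toFun θ := mixture F θ
  measurable' := Measure.measurable_of_measurable_coe _ fun _ hA => measurable_mixture hF hA

instance isMarkovKernel_mixtureKernel (F : V → Measure X) [∀ v, IsProbabilityMeasure (F v)]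
    (hF : ∀ A : Set X, MeasurableSet A → Measurable fun v => F v A) :
    IsMarkovKernel (mixtureKernel F hF) :=
  ⟨fun θ => inferInstanceAs (IsProbabilityMeasure (mixture F θ))⟩

/-- A version of the posterior disintegrates the law of the parameter and the whole sequence of
observations along the first `n` observations. -/
lemma IsPosterior.map_eq_compProd {F : V → Measure X} [∀ v, IsProbabilityMeasure (F v)]
    {hF : ∀ A : Set X, MeasurableSet A → Measurable fun v => F v A} {Q : Measure (Param V)}
    [IsProbabilityMeasure Q] {n : ℕ} {post : Kernel (Fin n → X) (Param V)}
    (h : IsPosterior F hF Q n post) :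
    (Q ⊗ₘ iidKernel (mixtureKernel F hF)).map (fun p => ((fun i : Fin n => p.2 i), p.1))
      = (Q ⊗ₘ iidKernel (mixtureKernel F hF)).map (fun p (i : Fin n) => p.2 i) ⊗ₘ post := by
  have hr : Measurable fun (x : ℕ → X) (i : Fin n) => x i := by fun_prop
  -- Samples of all sizes are realised as initial segments of one infinite sequence, so that all
  -- posteriors live on one space.
  have hs : sampling F hF n = (iidKernel (mixtureKernel F hF)).map fun x (i : Fin n) => x i := by
    ext1 θ
    rw [Kernel.map_apply _ hr, iidKernel_apply]
    exact (map_fin_infinitePi (mixture F θ) n).symm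
  have hj : (Q ⊗ₘ sampling F hF n).map Prod.swap
      = (Q ⊗ₘ iidKernel (mixtureKernel F hF)).map
        (fun p => ((fun i : Fin n => p.2 i), p.1)) := by
    rw [hs, Measure.compProd_map hr, Measure.map_map measurable_swap (by fun_prop)]
    rfl
  have hd := h.2.disintegrate
  rw [hj, Measure.fst, Measure.map_map measurable_fst (by fun_prop)] at hd
  exact hd.symm

lemma ae_of_iid {θ₀ : Param V} {F : V → Measure X} [∀ v, IsProbabilityMeasure (F v)]
    {Ω : Type*} [MeasurableSpace Ω] {μ : Measure Ω} {x : ℕ → Ω → X} (hx : iIndepFun x μ)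
    (hlaw : ∀ i, HasLaw (x i) (mixture F θ₀) μ) {p : (ℕ → X) → Prop}
    (hp : ∀ᵐ y ∂Measure.infinitePi (fun _ : ℕ => mixture F θ₀), p y) :
    ∀ᵐ ω ∂μ, p fun i => x i ω := by
  have hm : AEMeasurable (fun ω i => x i ω) μ := aemeasurable_pi_iff.2 fun i => (hlaw i).aemeasurable
  have hl := hx.hasLaw_infinitePi hlaw hm
  exact ae_of_ae_map hm (hl.map_eq ▸ hp)

lemma tendsto_one_of_subset {T : Type*} [MeasurableSpace T] {P : ℕ → Measure T}
    [∀ n, IsProbabilityMeasure (P n)] {S S' : Set T} (h : S ⊆ S')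
    (hS : Tendsto (fun n => P n S) atTop (𝓝 1)) : Tendsto (fun n => P n S') atTop (𝓝 1) :=
  tendsto_of_tendsto_of_tendsto_of_le_of_le hS tendsto_const_nhds
    (fun _ => measure_mono h) fun _ => prob_le_one

end FiniteMixture

open FiniteMixture

/-! ### Posterior consistency -/

theorem theorem1 {d : ℕ} {V : Set (EuclideanSpace ℝ (Fin d))} (hV : MeasurableSet V)
    {X : Type*} [MeasurableSpace X] [StandardBorelSpace X]
    (F : V → Measure X) [∀ v, IsProbabilityMeasure (F v)]
    (hF : ∀ A : Set X, MeasurableSet A → Measurable fun v => F v A)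
    (hident : FiniteMixture.Identifiable F)
    (π : PMF ℕ+)
    (D : ∀ k : ℕ+, Measure (FiniteMixture.Simplex k)) [∀ k, IsProbabilityMeasure (D k)]
    (G : ∀ k : ℕ+, Measure (Fin k → V)) [∀ k, IsProbabilityMeasure (G k)]
    (hdistinct : ∀ k : ℕ+, π k ≠ 0 → ∀ i j : Fin k, i < j → G k {v | v i = v j} = 0)
    (post : ∀ n : ℕ, Kernel (Fin n → X) (FiniteMixture.Param V))
    (hpost : ∀ n, FiniteMixture.IsPosterior F hF (FiniteMixture.prior π D G) n (post n)) :
    ∃ Θs : Set (FiniteMixture.Param V),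
      MeasurableSet Θs ∧ FiniteMixture.prior π D G Θs = 1 ∧
      ∀ θ₀ ∈ Θs, ∀ (Ω : Type*) [MeasurableSpace Ω] (μ : Measure Ω) [IsProbabilityMeasure μ]
        (x : ℕ → Ω → X), iIndepFun x μ →
        (∀ i, HasLaw (x i) (FiniteMixture.mixture F θ₀) μ) →
        (∀ ε : ℝ, 0 < ε → ∀ᵐ ω ∂μ,
          Tendsto (fun n => post n (fun i => x i ω) (FiniteMixture.permBall θ₀ ε))
            atTop (𝓝 1)) ∧
        ∀ᵐ ω ∂μ,
          Tendsto (fun n => post n (fun i => x i ω) {θ | θ.k = θ₀.k}) atTop (𝓝 1) := by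
  have := standardBorelSpace_param hV
  have := fun n => (hpost n).1
  set Q := prior π D G with hQ
  have hdist : ∀ᵐ θ ∂Q, θ ∈ distinctParams V := ae_mem_distinctParams hdistinct
  let 𝒰 := TopologicalSpace.countableBasis (Param V)
  -- Countability of `𝒰` allows a single null set for all `U`. Saturation makes the event depend on
  -- `P_θ` alone among parameters with distinct components.
  have hcons : ∀ᵐ θ ∂Q, ∀ U ∈ 𝒰, θ ∈ relabelSat U →
      ∀ᵐ x ∂Measure.infinitePi (fun _ : ℕ => mixture F θ),
        Tendsto (fun n => post n (fun i => x i) (relabelSat U)) atTop (𝓝 1) := by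
    refine (ae_ball_iff (TopologicalSpace.countable_countableBasis _)).2 fun U hU => ?_
    refine ae_tendsto_posterior (mixtureKernel F hF) Q post
      (fun n => (hpost n).map_eq_compProd) measurableSet_distinctParams hdist
      (measurableSet_relabelSat (measurableSet_of_isOpen_param
        (TopologicalSpace.isOpen_of_mem_countableBasis hU))) ?_
    intro θ hθ θ' hθ' he hB
    obtain ⟨σ, rfl⟩ := exists_permute_eq_of_mixing_eq (injective_of_mem_distinctParams hθ)
      (injective_of_mem_distinctParams hθ') (hident θ θ' he)
    exact permute_mem_relabelSat hB σ
  -- The set of bad parameters is null but not known to be measurable; here `Θs` is a measurable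
  -- null set containing it, and its complement is the required set.
  obtain ⟨Θs, hsub, hmeas, hfull⟩ := exists_measurable_superset_of_null hcons
  refine ⟨Θsᶜ, hmeas.compl, (prob_compl_eq_one_iff hmeas).2 hfull, ?_⟩
  intro θ₀ hθ₀ Ω _ μ _ x hx hlaw
  have hgood := not_not.1 fun h => hθ₀ (hsub h)
  have hball : ∀ ε : ℝ, 0 < ε → ∀ᵐ ω ∂μ,
      Tendsto (fun n => post n (fun i => x i ω) (permBall θ₀ ε)) atTop (𝓝 1) := by
    intro ε hε
    obtain ⟨U, hU, hθU, hUε⟩ :=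
      (TopologicalSpace.isBasis_countableBasis (Param V)).exists_subset_of_mem_open
        (show θ₀ ∈ {θ | paramDist θ θ₀ < ε} from (paramDist_self θ₀).trans_lt hε)
        (isOpen_lt (continuous_paramDist_left θ₀) continuous_const)
    have h1 := ae_of_iid hx hlaw (hgood U hU (subset_relabelSat U hθU))
    filter_upwards [h1] with ω hω
    exact tendsto_one_of_subset (relabelSat_subset_permBall fun θ hθ => hUε hθ) hω
  refine ⟨hball, ?_⟩
  -- Radius `1` is the truncation level of the metric, so this ball fixes the number of components.
  filter_upwards [hball 1 one_pos] with ω hω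
  exact tendsto_one_of_subset (permBall_one_subset θ₀) hω
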